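/- Let $\mathbb D=\{z\in\mathbb C:|z|<1\}$, let $m$ be area measure on $\mathbb D$, and put $d\mu(z,w)=|1-\overline w z|^{-4}\,dm(z)\,dm(w)$ on $\mathbb D\times\mathbb D$. Let $1<p<\infty$, $1<\alpha<2$, $\frac1\alpha+\frac1{\alpha'}=1$ and $p\ge\alpha'$. For $F$ analytic in $\mathbb D$ let $$\|F\|_{\mathcal B_p}=\left(\int_{\mathbb D}|F'(z)|^p(1-|z|)^{p-2}\,dm(z)\right)^{1/p}\in[0,\infty],$$ and let $S_4=S_4(F)$ be the set of all measurable functions $\omega:\mathbb D\times\mathbb D\to[0,\infty)$ with $$\int_{\mathbb D}\int_{\mathbb D}|F'(z)|^{\alpha'(p-1)}\,\omega(z,w)^{-\alpha'}\,(1-|z|)^{p\alpha'}\,d\mu(z,w)\le 1 ,$$ where $0^{-\alpha'}=\infty$ and $0\cdot\infty=0$. Then there is a constant $C\in(0,\infty)$, depending only on $p$ and $\alpha$, such that for every analytic $F:\mathbb D\to\mathbb C$ with $F(0)=0$ $$C^{-1}\,\|F\|_{\mathcal B_p}^p\ \le\ \inf_{\omega\in S_4}\left(\int_{\mathbb D}\int_{\mathbb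 D}\omega(z,w)^\alpha\,|F'(z)|^\alpha\,d\mu(z,w)\right)^{1/\alpha}\ \le\ C\,\|F\|_{\mathcal B_p}^p .$$ All quantities take values in $[0,\infty]$ and $\inf\emptyset=\infty$; in particular, the infimum is finite if and only if $\|F\|_{\mathcal B_p}<\infty$. -/

import Mathlib

open MeasureTheory
open scoped ENNReal NNReal

noncomputable section

namespace BesovDisc

/-- The open unit disc of the complex plane. -/
def disc : Set ℂ := Metric.ball 0 1

/-- The Besov seminorm `(∫_D |F'(z)|^p (1 - |z|)^(p - 2) dm(z))^(1/p)`, with values in `[0, ∞]`;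
it is infinite exactly when the analytic function `F` is not in the Besov space. -/
def besovSeminorm (p : ℝ) (F : ℂ → ℂ) : ℝ≥0∞ :=
  (∫⁻ z in disc, ‖deriv F z‖ₑ ^ p * ENNReal.ofReal ((1 - ‖z‖) ^ (p - 2))) ^ (1 / p)

/-- The measure `|1 - conj w * z|^(-4) dm(z) dm(w)` on `D × D`; points are `q = (z, w)`. -/
def mu : Measure (ℂ × ℂ) :=
  (volume.restrict (disc ×ˢ disc)).withDensity
    (fun q => ENNReal.ofReal (1 / ‖1 - (starRingEnd ℂ) q.2 * q.1‖ ^ 4))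

/-- The admissible weights: measurable `ω ≥ 0` (only the values on `D × D` matter) with
`∬ |F'(z)|^(α'(p-1)) ω(z,w)^(-α') (1 - |z|)^(p α') dμ(z,w) ≤ 1`.
The powers are taken in `[0, ∞]`, so that `ω^(-α') = ∞` where `ω = 0`. -/
def admissibleWeights (p α' : ℝ) (F : ℂ → ℂ) : Set (ℂ × ℂ → ℝ≥0) :=
  {ω | AEMeasurable ω mu ∧
    ∫⁻ q, ‖deriv F q.1‖ₑ ^ (α' * (p - 1)) * (ω q : ℝ≥0∞) ^ (-α') *
      ENNReal.ofReal ((1 - ‖q.1‖) ^ (p * α')) ∂mu ≤ 1}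

/-- `(∬ ω(z,w)^α |F'(z)|^α dμ(z,w))^(1/α)`, with values in `[0, ∞]`. -/
def weightedNorm (α : ℝ) (F : ℂ → ℂ) (ω : ℂ × ℂ → ℝ≥0) : ℝ≥0∞ :=
  (∫⁻ q, (ω q : ℝ≥0∞) ^ α * ‖deriv F q.1‖ₑ ^ α ∂mu) ^ (1 / α)

end BesovDisc

end

/-! Integrating `mu` over `w` leaves the weight `π / (1 - |z|²)²`, which is comparable to `(1 -
|z|)⁻²`. So the energy `J = ∬ |F'|^p (1 - |z|)^p dμ` equals `‖F‖^p` up to a factor `4`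
(`besovSeminorm_le_energy`, `energy_le_besovSeminorm`). The infimum is in fact exactly `J`.
Splitting the integrand as `(ω |F'|) · (|F'|^(p-1) ω⁻¹ (1 - |z|)^p)` and applying Hölder shows that
no admissible `ω` does better (`energy_le_weightedNorm`). The weight giving equality in Hölder
attains `J` when `J` is finite (`exists_weightedNorm_le_energy`). -/

namespace BesovDisc

/-! ### Möbius involution and the kernel integral -/

/-- The disc involution exchanging `0` and `z`. -/
noncomputable def discInvolution (z w : ℂ) : ℂ := (z - w) / (1 - (starRingEnd ℂ) z * w)

lemma mem_disc {z : ℂ} : z ∈ disc ↔ ‖z‖ < 1 := by simp [disc]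

lemma measurableSet_disc : MeasurableSet disc := Metric.isOpen_ball.measurableSet

lemma one_sub_conj_mul_ne_zero {z w : ℂ} (hz : z ∈ disc) (hw : w ∈ disc) :
    1 - (starRingEnd ℂ) z * w ≠ 0 := by
  rw [mem_disc] at hz hw
  intro h
  have h1 : ‖(starRingEnd ℂ) z * w‖ = 1 := by rw [← sub_eq_zero.mp h]; simp
  rw [norm_mul, RCLike.norm_conj] at h1
  nlinarith [norm_nonneg z, norm_nonneg w]

/-- Positivity of the right side on the disc is what makes the involution a self-map of the disc. -/
lemma normSq_sub_normSq_involution (z w : ℂ) :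
    Complex.normSq (1 - (starRingEnd ℂ) z * w) - Complex.normSq (z - w) =
      (1 - Complex.normSq z) * (1 - Complex.normSq w) := by
  simp only [Complex.normSq_apply, Complex.sub_re, Complex.sub_im, Complex.mul_re, Complex.mul_im,
    Complex.conj_re, Complex.conj_im, Complex.one_re, Complex.one_im]
  ring

lemma normSq_lt_one {z : ℂ} (hz : z ∈ disc) : Complex.normSq z < 1 := by
  rw [mem_disc] at hz
  rw [Complex.normSq_eq_norm_sq]
  nlinarith [norm_nonneg z]

lemma discInvolution_mem {z w : ℂ} (hz : z ∈ disc) (hw : w ∈ disc) :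
    discInvolution z w ∈ disc := by
  have hne := one_sub_conj_mul_ne_zero hz hw
  rw [mem_disc, discInvolution, norm_div, div_lt_one (norm_pos_iff.mpr hne)]
  have h := normSq_sub_normSq_involution z w
  rw [Complex.normSq_eq_norm_sq (1 - _), Complex.normSq_eq_norm_sq (z - w)] at h
  have h2 := mul_pos (sub_pos.mpr (normSq_lt_one hz)) (sub_pos.mpr (normSq_lt_one hw))
  exact lt_of_pow_lt_pow_left₀ 2 (norm_nonneg _) (by linarith)

lemma one_sub_conj_mul_self (z : ℂ) :
    1 - (starRingEnd ℂ) z * z = ((1 - ‖z‖ ^ 2 : ℝ) : ℂ) := by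
  rw [mul_comm, Complex.mul_conj, Complex.normSq_eq_norm_sq]; push_cast; ring

lemma discInvolution_discInvolution {z w : ℂ} (hz : z ∈ disc) (hw : w ∈ disc) :
    discInvolution z (discInvolution z w) = w := by
  have h1 := one_sub_conj_mul_ne_zero hz hw
  have h2 := one_sub_conj_mul_ne_zero hz hz
  have h3 := one_sub_conj_mul_ne_zero hz (discInvolution_mem hz hw)
  rw [discInvolution, div_eq_iff h3]
  unfold discInvolution
  have h1' : 1 - w * (starRingEnd ℂ) z ≠ 0 := by rwa [mul_comm]
  field_simp
  ring

lemma hasDerivAt_discInvolution {z w : ℂ} (hz : z ∈ disc) (hw : w ∈ disc) :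
    HasDerivAt (discInvolution z)
      (-(1 - (starRingEnd ℂ) z * z) / (1 - (starRingEnd ℂ) z * w) ^ 2) w := by
  have h1 := one_sub_conj_mul_ne_zero hz hw
  have h := ((hasDerivAt_id w).const_sub z).div
    (((hasDerivAt_id w).const_mul ((starRingEnd ℂ) z)).const_sub 1) h1
  refine h.congr_deriv ?_
  simp only [id]
  ring

/-- The real determinant of multiplication by `a` is the field norm of `a` from `ℂ` to `ℝ`. -/
lemma det_restrictScalars_toSpanSingleton (a : ℂ) :
    ((ContinuousLinearMap.toSpanSingleton ℂ a).restrictScalars ℝ).det = ‖a‖ ^ 2 := by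
  have h : (((ContinuousLinearMap.toSpanSingleton ℂ a).restrictScalars ℝ : ℂ →L[ℝ] ℂ) : ℂ →ₗ[ℝ] ℂ)
      = Algebra.lmul ℝ ℂ a := by
    ext; simp [mul_comm]
  rw [ContinuousLinearMap.det, h, ← Complex.normSq_eq_norm_sq, ← Algebra.norm_complex_apply]
  rfl

/-- The area of the disc, computed in the coordinate `discInvolution z`. -/
lemma setLIntegral_kernel {z : ℂ} (hz : z ∈ disc) :
    ∫⁻ w in disc, ENNReal.ofReal (1 / ‖1 - (starRingEnd ℂ) w * z‖ ^ 4) =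
      ENNReal.ofReal (Real.pi / (1 - ‖z‖ ^ 2) ^ 2) := by
  have hpos : 0 < 1 - ‖z‖ ^ 2 := by
    rw [← Complex.normSq_eq_norm_sq]; exact sub_pos.mpr (normSq_lt_one hz)
  have himage : discInvolution z '' disc = disc := by
    refine Set.Subset.antisymm (Set.image_subset_iff.mpr fun w hw => discInvolution_mem hz hw) ?_
    exact fun w hw => ⟨_, discInvolution_mem hz hw, discInvolution_discInvolution hz hw⟩
  have hinj : Set.InjOn (discInvolution z) disc := fun w hw w' hw' h => by
    rw [← discInvolution_discInvolution hz hw, h, discInvolution_discInvolution hz hw']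
  have hcov := lintegral_image_eq_lintegral_abs_det_fderiv_mul volume measurableSet_disc
    (fun w hw => ((hasDerivAt_discInvolution hz hw).hasFDerivAt.restrictScalars ℝ).hasFDerivWithinAt)
    hinj (fun _ => 1)
  have hvol : volume disc = ENNReal.ofReal Real.pi := by
    rw [disc, Complex.volume_ball]
    simp [ENNReal.ofReal, Real.toNNReal_of_nonneg Real.pi_pos.le, NNReal.pi]
    rfl
  rw [himage, setLIntegral_one, hvol] at hcov
  -- The Jacobian of the involution is the kernel times `(1 - |z|²)²`.
  have hjac : ∫⁻ w in disc, ENNReal.ofReal ((1 - ‖z‖ ^ 2) ^ 2) *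
      ENNReal.ofReal (1 / ‖1 - (starRingEnd ℂ) w * z‖ ^ 4) = ENNReal.ofReal Real.pi := by
    rw [hcov]
    refine setLIntegral_congr_fun measurableSet_disc fun w hw => ?_
    have hn : ‖1 - (starRingEnd ℂ) w * z‖ = ‖1 - (starRingEnd ℂ) z * w‖ := by
      rw [← RCLike.norm_conj]; congr 1; simp [mul_comm]
    simp only [mul_one]
    rw [← ENNReal.ofReal_mul (by positivity)]
    congr 1
    erw [det_restrictScalars_toSpanSingleton]
    rw [abs_of_nonneg (by positivity), one_sub_conj_mul_self, norm_div, norm_neg, norm_pow,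
      Complex.norm_real, Real.norm_of_nonneg hpos.le, hn]
    have := norm_ne_zero_iff.mpr (one_sub_conj_mul_ne_zero hz hw)
    field_simp
  rw [lintegral_const_mul' _ _ ENNReal.ofReal_ne_top] at hjac
  rw [ENNReal.ofReal_div_of_pos (by positivity), ← hjac, mul_comm,
    ENNReal.mul_div_cancel_right (by rw [Ne, ENNReal.ofReal_eq_zero, not_le]; positivity) ENNReal.ofReal_ne_top]

lemma one_sub_norm_pos {z : ℂ} (hz : z ∈ disc) : 0 < 1 - ‖z‖ := sub_pos.mpr (mem_disc.mp hz)

lemma lintegral_mu_fst {g : ℂ → ℝ≥0∞} (hg : Measurable g) :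
    ∫⁻ q, g q.1 ∂mu = ∫⁻ z in disc, g z * ENNReal.ofReal (Real.pi / (1 - ‖z‖ ^ 2) ^ 2) := by
  set k : ℂ × ℂ → ℝ≥0∞ := fun q => ENNReal.ofReal (1 / ‖1 - (starRingEnd ℂ) q.2 * q.1‖ ^ 4)
  have hk : Measurable k := by
    have : Measurable fun q : ℂ × ℂ => (starRingEnd ℂ) q.2 :=
      (Complex.continuous_conj.comp continuous_snd).measurable
    fun_prop
  have hg' : Measurable fun q : ℂ × ℂ => g q.1 := hg.comp measurable_fst
  have hkz (z : ℂ) : Measurable fun w => k (z, w) := hk.comp measurable_prodMk_left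
  have hint {z : ℂ} (hz : z ∈ disc) : ∫⁻ w in disc, k (z, w) =
      ENNReal.ofReal (Real.pi / (1 - ‖z‖ ^ 2) ^ 2) := setLIntegral_kernel hz
  have hmu : mu = ((volume.restrict disc).prod (volume.restrict disc)).withDensity k := by
    rw [mu, Measure.volume_eq_prod, Measure.prod_restrict]
  clear_value k
  calc ∫⁻ q, g q.1 ∂mu
      = ∫⁻ q, k q * g q.1 ∂((volume.restrict disc).prod (volume.restrict disc)) := by
        rw [hmu]; exact lintegral_withDensity_eq_lintegral_mul _ hk hg'
    _ = ∫⁻ z in disc, ∫⁻ w in disc, k (z, w) * g z :=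
        lintegral_prod _ (hk.mul hg').aemeasurable
    _ = _ := setLIntegral_congr_fun measurableSet_disc fun z hz => by
        rw [lintegral_mul_const _ (hkz z), hint hz, mul_comm]

lemma ae_mu_fst_mem_disc : ∀ᵐ q ∂mu, q.1 ∈ disc := by
  refine (withDensity_absolutelyContinuous _ _).ae_le ?_
  filter_upwards [ae_restrict_mem (measurableSet_disc.prod measurableSet_disc)] with q hq
  exact hq.1

/-! ### Energy versus Besov seminorm -/

/-- The Besov energy `∬ |F'(z)|^p (1 - |z|)^p dμ(z, w)`. -/
noncomputable def energy (p : ℝ) (F : ℂ → ℂ) : ℝ≥0∞ :=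
  ∫⁻ q, ‖deriv F q.1‖ₑ ^ p * ENNReal.ofReal (1 - ‖q.1‖) ^ p ∂mu

lemma lintegral_const_mul_energy (c : ℝ≥0∞) (p : ℝ) (F : ℂ → ℂ) :
    ∫⁻ q, c * (‖deriv F q.1‖ₑ ^ p * ENNReal.ofReal (1 - ‖q.1‖) ^ p) ∂mu = c * energy p F := by
  refine lintegral_const_mul c ?_
  have := measurable_deriv F
  fun_prop

lemma energy_eq (p : ℝ) (F : ℂ → ℂ) :
    energy p F = ∫⁻ z in disc, ‖deriv F z‖ₑ ^ p * ENNReal.ofReal (1 - ‖z‖) ^ p *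
      ENNReal.ofReal (Real.pi / (1 - ‖z‖ ^ 2) ^ 2) := by
  refine lintegral_mu_fst (g := fun z => ‖deriv F z‖ₑ ^ p * ENNReal.ofReal (1 - ‖z‖) ^ p) ?_
  have := measurable_deriv F
  fun_prop

lemma besovSeminorm_rpow {p : ℝ} (hp : 0 < p) (F : ℂ → ℂ) :
    besovSeminorm p F ^ p =
      ∫⁻ z in disc, ‖deriv F z‖ₑ ^ p * ENNReal.ofReal ((1 - ‖z‖) ^ (p - 2)) := by
  rw [besovSeminorm, ← ENNReal.rpow_mul, one_div_mul_cancel hp.ne', ENNReal.rpow_one]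

lemma energy_le_besovSeminorm {p : ℝ} (hp : 0 < p) (F : ℂ → ℂ) :
    energy p F ≤ 4 * besovSeminorm p F ^ p := by
  rw [energy_eq, besovSeminorm_rpow hp, ← lintegral_const_mul' _ _ (by norm_num)]
  refine setLIntegral_mono' measurableSet_disc fun z hz => ?_
  have h := one_sub_norm_pos hz
  rw [mul_assoc, mul_left_comm 4, ENNReal.ofReal_rpow_of_pos h, ← ENNReal.ofReal_mul (by positivity),
    ← ENNReal.ofReal_ofNat 4, ← ENNReal.ofReal_mul (by norm_num)]
  refine mul_le_mul_right (ENNReal.ofReal_le_ofReal ?_) _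
  rw [Real.rpow_sub h, Real.rpow_two, ← mul_div_assoc, ← mul_div_assoc, mul_comm _ Real.pi]
  gcongr
  · exact Real.pi_le_four
  · nlinarith [norm_nonneg z]

lemma besovSeminorm_le_energy {p : ℝ} (hp : 0 < p) (F : ℂ → ℂ) :
    besovSeminorm p F ^ p ≤ 4 * energy p F := by
  rw [energy_eq, besovSeminorm_rpow hp, ← lintegral_const_mul' _ _ (by norm_num)]
  refine setLIntegral_mono' measurableSet_disc fun z hz => ?_
  have h := one_sub_norm_pos hz
  have h0 := norm_nonneg z
  rw [mul_assoc (‖deriv F z‖ₑ ^ p), mul_left_comm 4, ENNReal.ofReal_rpow_of_pos h, ← ENNReal.ofReal_mul (by positivity),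
    ← ENNReal.ofReal_ofNat 4, ← ENNReal.ofReal_mul (by norm_num)]
  gcongr
  have h2 : 1 - ‖z‖ ^ 2 = (1 - ‖z‖) * (1 + ‖z‖) := by ring
  rw [Real.rpow_sub h, Real.rpow_two, ← mul_div_assoc, ← mul_div_assoc, h2, mul_pow,
    div_le_div_iff₀ (by positivity) (by positivity)]
  have h3 : (1 + ‖z‖) ^ 2 ≤ 4 * Real.pi := by nlinarith [Real.pi_gt_three]
  calc (1 - ‖z‖) ^ p * ((1 - ‖z‖) ^ 2 * (1 + ‖z‖) ^ 2)
      = ((1 - ‖z‖) ^ p * (1 - ‖z‖) ^ 2) * (1 + ‖z‖) ^ 2 := by ring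
    _ ≤ ((1 - ‖z‖) ^ p * (1 - ‖z‖) ^ 2) * (4 * Real.pi) := by gcongr
    _ = _ := by ring

/-! ### Hölder's inequality and its equality case -/

/-- Since `1 - |z| > 0` holds `mu`-almost everywhere, the power can be taken in `ℝ≥0∞`, where the
whole integrand obeys one set of exponent rules. -/
lemma admissible_iff (p α' : ℝ) (F : ℂ → ℂ) (ω : ℂ × ℂ → ℝ≥0) :
    ω ∈ admissibleWeights p α' F ↔ AEMeasurable ω mu ∧
      ∫⁻ q, ‖deriv F q.1‖ₑ ^ (α' * (p - 1)) * (ω q : ℝ≥0∞) ^ (-α') *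
        ENNReal.ofReal (1 - ‖q.1‖) ^ (p * α') ∂mu ≤ 1 := by
  have : ∫⁻ q, ‖deriv F q.1‖ₑ ^ (α' * (p - 1)) * (ω q : ℝ≥0∞) ^ (-α') *
        ENNReal.ofReal ((1 - ‖q.1‖) ^ (p * α')) ∂mu =
      ∫⁻ q, ‖deriv F q.1‖ₑ ^ (α' * (p - 1)) * (ω q : ℝ≥0∞) ^ (-α') *
        ENNReal.ofReal (1 - ‖q.1‖) ^ (p * α') ∂mu := by
    refine lintegral_congr_ae ?_
    filter_upwards [ae_mu_fst_mem_disc] with q hq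
    rw [ENNReal.ofReal_rpow_of_pos (one_sub_norm_pos hq)]
  rw [admissibleWeights, Set.mem_ofPred_eq, this]

lemma energy_le_weightedNorm {p α α' : ℝ} (hp : 1 < p) (h : α.HolderConjugate α') {F : ℂ → ℂ}
    {ω : ℂ × ℂ → ℝ≥0} (hω : ω ∈ admissibleWeights p α' F) :
    energy p F ≤ weightedNorm α F ω := by
  rw [admissible_iff] at hω
  obtain ⟨hm, hle⟩ := hω
  have hα' := h.symm.pos
  have hd := measurable_deriv F
  have hωm : AEMeasurable (fun q => (ω q : ℝ≥0∞)) mu := hm.coe_nnreal_ennreal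
  have hdm : Measurable fun q : ℂ × ℂ => ‖deriv F q.1‖ₑ := by fun_prop
  have hrm : Measurable fun q : ℂ × ℂ => ENNReal.ofReal (1 - ‖q.1‖) := by fun_prop
  set f : ℂ × ℂ → ℝ≥0∞ := fun q => ω q * ‖deriv F q.1‖ₑ with hf
  set g : ℂ × ℂ → ℝ≥0∞ := fun q =>
    (‖deriv F q.1‖ₑ ^ (α' * (p - 1)) * (ω q : ℝ≥0∞) ^ (-α') *
        ENNReal.ofReal (1 - ‖q.1‖) ^ (p * α')) ^ (1 / α') with hg
  have hGm : AEMeasurable (fun q : ℂ × ℂ => ‖deriv F q.1‖ₑ ^ (α' * (p - 1)) *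
      (ω q : ℝ≥0∞) ^ (-α') * ENNReal.ofReal (1 - ‖q.1‖) ^ (p * α')) mu :=
    ((hdm.pow_const _).aemeasurable.mul (hωm.pow_const _)).mul (hrm.pow_const _).aemeasurable
  have hfin := ae_lt_top' hGm (hle.trans_lt ENNReal.one_lt_top).ne
  calc energy p F ≤ ∫⁻ q, (f * g) q ∂mu := by
        refine lintegral_mono_ae ?_
        filter_upwards [hfin, ae_mu_fst_mem_disc] with q hq hz
        have hr0 : ENNReal.ofReal (1 - ‖q.1‖) ≠ 0 := by
          simpa using mem_disc.mp hz
        have ha_top : ‖deriv F q.1‖ₑ ≠ ⊤ := enorm_ne_top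
        simp only [Pi.mul_apply, hf, hg]
        generalize ENNReal.ofReal (1 - ‖q.1‖) = r at *
        generalize ‖deriv F q.1‖ₑ = a at *
        rcases eq_or_ne a 0 with rfl | ha
        · simp [ENNReal.zero_rpow_of_pos (zero_lt_one.trans hp)]
        -- Where `F' ≠ 0`, a zero of `ω` would make the constraint integrand infinite, which happens
        -- only on a null set.
        have hω0 : (ω q : ℝ≥0∞) ≠ 0 := by
          intro h0
          rw [h0, ENNReal.zero_rpow_of_neg (by linarith), ENNReal.mul_top, ENNReal.top_mul] at hq
          · exact lt_irrefl _ hq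
          · simp [ENNReal.rpow_eq_zero_iff, hr0, mul_pos (zero_lt_one.trans hp) hα',
              (mul_pos (zero_lt_one.trans hp) hα').le]
          · simp [ENNReal.rpow_eq_zero_iff, ha, ha_top]
        rw [ENNReal.mul_rpow_of_nonneg _ _ (by positivity),
          ENNReal.mul_rpow_of_nonneg _ _ (by positivity), ← ENNReal.rpow_mul, ← ENNReal.rpow_mul,
          ← ENNReal.rpow_mul, show α' * (p - 1) * (1 / α') = p - 1 by field_simp,
          show -α' * (1 / α') = -1 by field_simp, show p * α' * (1 / α') = p by field_simp,
          ENNReal.rpow_neg_one]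
        rw [show (ω q : ℝ≥0∞) * a * (a ^ (p - 1) * (ω q : ℝ≥0∞)⁻¹ * r ^ p) =
          ((ω q : ℝ≥0∞) * (ω q : ℝ≥0∞)⁻¹) * (a * a ^ (p - 1)) * r ^ p by ring,
          ENNReal.mul_inv_cancel hω0 ENNReal.coe_ne_top, one_mul]
        nth_rw 2 [← ENNReal.rpow_one a]
        rw [← ENNReal.rpow_add _ _ ha ha_top, add_sub_cancel]
    _ ≤ (∫⁻ q, f q ^ α ∂mu) ^ (1 / α) * (∫⁻ q, g q ^ α' ∂mu) ^ (1 / α') :=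
        ENNReal.lintegral_mul_le_Lp_mul_Lq _ h (hωm.mul hdm.aemeasurable) (hGm.pow_const _)
    _ ≤ weightedNorm α F ω * 1 := by
        gcongr
        · rw [weightedNorm]
          simp only [hf, ENNReal.mul_rpow_of_nonneg _ _ h.nonneg]
          exact le_rfl
        · refine ENNReal.rpow_le_one ?_ (by positivity)
          simpa only [hg, ← ENNReal.rpow_mul, one_div_mul_cancel hα'.ne', ENNReal.rpow_one]
    _ = _ := mul_one _

lemma exists_weightedNorm_le_energy {p α α' : ℝ} (h : α.HolderConjugate α') (hαp : α < p)
    {F : ℂ → ℂ} (htop : energy p F ≠ ⊤) :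
    ∃ ω ∈ admissibleWeights p α' F, weightedNorm α F ω ≤ energy p F := by
  have hα := h.pos
  have hα1 := h.lt
  have hα' := h.symm.pos
  have hp : 0 < p := hα.trans hαp
  have hinv := h.inv_add_inv_eq_one
  have hd := measurable_deriv F
  have hdm : Measurable fun q : ℂ × ℂ => ‖deriv F q.1‖ₑ := by fun_prop
  have hrm : Measurable fun q : ℂ × ℂ => ENNReal.ofReal (1 - ‖q.1‖) := by fun_prop
  simp only [admissible_iff]
  rcases eq_or_ne (energy p F) 0 with h0 | h0
  · have hae : ∀ᵐ q ∂mu, ‖deriv F q.1‖ₑ = 0 := by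
      have h1 := (lintegral_eq_zero_iff ((hdm.pow_const p).mul (hrm.pow_const p))).mp h0
      filter_upwards [h1, ae_mu_fst_mem_disc] with q hq hz
      have hr0 : ENNReal.ofReal (1 - ‖q.1‖) ≠ 0 := by simpa using mem_disc.mp hz
      simp only [Pi.mul_apply, Pi.zero_apply, mul_eq_zero] at hq
      simpa [ENNReal.rpow_eq_zero_iff_of_pos hp, hr0] using hq
    -- With `F' = 0` almost everywhere both integrals vanish, so any positive constant weight would
    -- do.
    refine ⟨fun _ => 1, ⟨aemeasurable_const, ?_⟩, ?_⟩
    · rw [lintegral_congr_ae (g := fun _ => 0)]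
      · simp
      · filter_upwards [hae] with q hq
        simp [hq, ENNReal.zero_rpow_of_pos (mul_pos hα' (sub_pos.mpr (hα1.trans hαp)))]
    · rw [weightedNorm, lintegral_congr_ae (g := fun _ => 0)]
      · simp [hα]
      · filter_upwards [hae] with q hq
        simp [hq, hα]
  · set J := energy p F with hJ
    -- Equality in Hölder forces `(ω |F'|)^α` to be proportional to `|F'|^p (1 - |z|)^p`; the factor
    -- `J ^ (1 / α')` normalises the constraint.
    set W : ℂ × ℂ → ℝ≥0∞ := fun q => J ^ (1 / α') * ‖deriv F q.1‖ₑ ^ (p / α - 1) *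
      ENNReal.ofReal (1 - ‖q.1‖) ^ (p / α) with hW
    have hWm : Measurable W := ((hdm.pow_const _).const_mul _).mul (hrm.pow_const _)
    -- This is where `α < p` keeps `W` finite at the zeros of `F'`.
    have he : 0 ≤ p / α - 1 := by rw [sub_nonneg, le_div_iff₀ hα]; linarith
    have hWtop (q) : W q ≠ ⊤ := by
      refine ENNReal.mul_ne_top (ENNReal.mul_ne_top ?_ ?_) ?_
      · exact ENNReal.rpow_ne_top_of_nonneg (by positivity) htop
      · exact ENNReal.rpow_ne_top_of_nonneg he enorm_ne_top
      · exact ENNReal.rpow_ne_top_of_nonneg (by positivity) ENNReal.ofReal_ne_top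
    refine ⟨fun q => (W q).toNNReal, ⟨hWm.ennreal_toNNReal.aemeasurable, ?_⟩, ?_⟩
    · calc _ ≤ ∫⁻ q, J⁻¹ * (‖deriv F q.1‖ₑ ^ p * ENNReal.ofReal (1 - ‖q.1‖) ^ p) ∂mu := by
            refine lintegral_mono_ae ?_
            filter_upwards [ae_mu_fst_mem_disc] with q hz
            have hr0 : ENNReal.ofReal (1 - ‖q.1‖) ≠ 0 := by simpa using mem_disc.mp hz
            have hrt : ENNReal.ofReal (1 - ‖q.1‖) ≠ ⊤ := ENNReal.ofReal_ne_top
            have hat : ‖deriv F q.1‖ₑ ≠ ⊤ := enorm_ne_top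
            rw [ENNReal.coe_toNNReal (hWtop q)]
            simp only [hW]
            generalize ENNReal.ofReal (1 - ‖q.1‖) = r at *
            generalize ‖deriv F q.1‖ₑ = a at *
            rcases eq_or_ne a 0 with rfl | ha
            -- At a zero of `F'` the convention `0 * ∞ = 0` makes the constraint integrand vanish.
            · simp [ENNReal.zero_rpow_of_pos (mul_pos hα' (sub_pos.mpr (hα1.trans hαp)))]
            have hne {x : ℝ≥0∞} (y : ℝ) (hx : x ≠ 0) (hx' : x ≠ ⊤) : x ^ y ≠ 0 :=
              (ENNReal.rpow_pos (pos_iff_ne_zero.mpr hx) hx').ne'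
            rw [ENNReal.mul_rpow_of_ne_zero
                (mul_ne_zero (hne _ h0 htop) (hne _ ha hat)) (hne _ hr0 hrt),
              ENNReal.mul_rpow_of_ne_zero (hne _ h0 htop) (hne _ ha hat),
              ← ENNReal.rpow_mul, ← ENNReal.rpow_mul, ← ENNReal.rpow_mul,
              show 1 / α' * -α' = -1 by field_simp, ENNReal.rpow_neg_one]
            rw [show a ^ (α' * (p - 1)) * (J⁻¹ * a ^ ((p / α - 1) * -α') * r ^ (p / α * -α')) *
                r ^ (p * α') = J⁻¹ * ((a ^ (α' * (p - 1)) * a ^ ((p / α - 1) * -α')) *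
                (r ^ (p / α * -α') * r ^ (p * α'))) by ring,
              ← ENNReal.rpow_add _ _ ha hat, ← ENNReal.rpow_add _ _ hr0 hrt]
            have e0 : p / α = p - p / α' := by
              rw [div_eq_mul_inv, div_eq_mul_inv]; linear_combination p * hinv
            rw [show α' * (p - 1) + (p / α - 1) * -α' = p by rw [e0]; field_simp; ring,
              show p / α * -α' + p * α' = p by rw [e0]; field_simp; ring]
        _ = J⁻¹ * J := lintegral_const_mul_energy _ p F
        _ ≤ 1 := (ENNReal.inv_mul_cancel h0 htop).le
    · have hpt : ∫⁻ q, ((W q).toNNReal : ℝ≥0∞) ^ α * ‖deriv F q.1‖ₑ ^ α ∂mu = J ^ (α / α') * J := by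
        rw [hJ, ← lintegral_const_mul_energy, ← hJ]
        refine lintegral_congr fun q => ?_
        rw [ENNReal.coe_toNNReal (hWtop q)]
        simp only [hW]
        generalize ENNReal.ofReal (1 - ‖q.1‖) = r at *
        generalize ‖deriv F q.1‖ₑ = a at *
        rw [ENNReal.mul_rpow_of_nonneg _ _ hα.le, ENNReal.mul_rpow_of_nonneg _ _ hα.le,
          ← ENNReal.rpow_mul, ← ENNReal.rpow_mul, ← ENNReal.rpow_mul,
          show (p / α - 1) * α = p - α by field_simp, show p / α * α = p by field_simp,
          show 1 / α' * α = α / α' by ring]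
        have : a ^ p = a ^ (p - α) * a ^ α := by
          rw [← ENNReal.rpow_add_of_nonneg _ _ (by linarith) hα.le, sub_add_cancel]
        rw [this]
        ring
      rw [weightedNorm, hpt]
      nth_rw 2 [← ENNReal.rpow_one J]
      rw [← ENNReal.rpow_add _ _ h0 htop, ← ENNReal.rpow_mul]
      have e1 : (α / α' + 1) * (1 / α) = 1 := by
        field_simp at hinv ⊢; linarith
      rw [e1, ENNReal.rpow_one]

end BesovDisc

theorem theorem5 (p α α' : ℝ) (hp : 1 < p) (hα₁ : 1 < α) (hα₂ : α < 2)
    (hconj : 1 / α + 1 / α' = 1) (hpα : α' ≤ p) :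
    ∃ C : ℝ≥0, 0 < C ∧ ∀ F : ℂ → ℂ, AnalyticOnNhd ℂ F BesovDisc.disc → F 0 = 0 →
      BesovDisc.besovSeminorm p F ^ p ≤
          (C : ℝ≥0∞) * (⨅ ω ∈ BesovDisc.admissibleWeights p α' F, BesovDisc.weightedNorm α F ω) ∧
        (⨅ ω ∈ BesovDisc.admissibleWeights p α' F, BesovDisc.weightedNorm α F ω) ≤
          (C : ℝ≥0∞) * BesovDisc.besovSeminorm p F ^ p := by
  have h : α.HolderConjugate α' :=
    Real.holderConjugate_iff.mpr ⟨hα₁, by simpa only [one_div] using hconj⟩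
  have hp0 : 0 < p := zero_lt_one.trans hp
  -- From `α < 2`; with `α' ≤ p` it yields the `α < p` needed for the extremal weight.
  have hα' : α < α' := by
    have h1 := h.symm.pos
    have h2 : α + α' = α * α' := by
      have h4 := h.pos
      field_simp at hconj
      linarith
    nlinarith
  refine ⟨4, by norm_num, fun F _ _ => ⟨?_, ?_⟩⟩
  · refine (BesovDisc.besovSeminorm_le_energy hp0 F).trans ?_
    push_cast
    gcongr
    exact le_iInf₂ fun ω hω => BesovDisc.energy_le_weightedNorm hp h hω
  · have hle := BesovDisc.energy_le_besovSeminorm hp0 F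
    -- Infinite energy forces an infinite seminorm, so the upper bound is then trivial.
    rcases eq_or_ne (BesovDisc.energy p F) ⊤ with htop | htop
    · rw [htop, top_le_iff] at hle
      push_cast
      rw [hle]
      exact le_top
    · obtain ⟨ω, hω, hωle⟩ :=
        BesovDisc.exists_weightedNorm_le_energy h (hα'.trans_le hpα) htop
      exact (iInf₂_le ω hω).trans (hωle.trans (by exact_mod_cast hle))
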